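/- **Setting.** Let $(H,\rho)$ be a nonempty complete $\mathrm{CAT}(0)$ space, that is, a nonempty complete metric space in which any two points are joined by a geodesic and every geodesic triangle satisfies $\rho(u,v)\le\|\bar u-\bar v\|$ for all points $u,v$ of the triangle and their comparison points $\bar u,\bar v$ in a Euclidean comparison triangle. Assume that $H$ has the geodesic extension property: for every $L>0$, every isometric map $\gamma:[0,L]\to H$ extends to an isometric map $\eta:\mathbb R\to H$. A normalized geodesic issuing from $p$ is a map $\gamma:[0,1]\to H$ of constant speed with $\gamma(0)=p$; put $\zeta(\gamma)=0$ if $\gamma(1)=p$ and $\zeta(\gamma)=1$ otherwise. Let $\gamma_{p,x}$ be the unique normalized geodesic from $p$ to $x$. For $q,r\ne p$ let $\overline\angle_p(q,r)$ be the angle at $\bar p$ of a Euclidean comparison triangle of $p,q,r$; put $\overline\angle_p(p,p)=0$ and $\overline\angle_p(p,r)=\overline\angle_p(r,p)=\pi/2$ for $r\neq p$. The pseudometric $\angle_p(\gamma_1,\gamma_2)=\lim_{s,t\to0^+}\overline\angle_p(\gamma_1(s),\gamma_2(t))$ on the normalized geodesics issuing from $p$ has as its metric identification the space of directions $S_p$.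 The tangent space $T_pH$ is the quotient of $[0,\infty)\times S_p$ by the relation $(t_1,\gamma_1)\sim(t_2,\gamma_2)$ iff $t_1\zeta(\gamma_1)=t_2\zeta(\gamma_2)=0$, or $t_1\zeta(\gamma_1)=t_2\zeta(\gamma_2)>0$ and $\gamma_1=\gamma_2$ in $S_p$. Write $t\gamma$ for the class of $(t,\gamma)$ and $\gamma$ for $1\gamma$. The space $T_pH$ carries the metric $$d_p(t_1\gamma_1,t_2\gamma_2)=\sqrt{t_1^2\zeta(\gamma_1)+t_2^2\zeta(\gamma_2)-2t_1t_2\zeta(\gamma_1)\zeta(\gamma_2)\cos\angle_p(\gamma_1,\gamma_2)}.$$ Put $0_p=0\gamma_{p,p}$, $\|u\|_p=d_p(0_p,u)$ and $g_p(u,v)=\tfrac12\left(\|u\|_p^2+\|v\|_p^2-d_p(u,v)^2\right)$. Let $A$ be a set-valued vector field on $H$, that is, $Ap\subset T_pH$ for every $p\in H$, and let $\operatorname{dom}A=\{p\in H: Ap\neq\emptyset\}$. Assume that $A$ is monotone, $$g_p(\eta,\gamma_{p,q})\le-g_q(\nu,\gamma_{q,p})\qquad\text{whenever } p,q\in H,\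 \eta\in Ap,\ \nu\in Aq,$$ and satisfies the surjectivity condition: for all $t>0$ and $x\in H$ there is $p\in H$ with $t\rho(p,x)\gamma_{p,x}\in Ap$. Its resolvents are $J_\lambda x=\{z\in H:\lambda^{-1}\rho(z,x)\gamma_{z,x}\in Az\}$ for $\lambda>0$, and $J_0x=\{x\}$. **Theorem.** Under these assumptions, $J_\lambda x$ consists of exactly one point for all $\lambda\ge0$ and $x\in H$, so that $J_\lambda:H\to H$ is a map. For all $t\ge0$ and $x\in\overline{\operatorname{dom}A}$ the limit $$S(t)x=\lim_{k\to\infty}J_{t/k}^{\,k}x$$ exists and lies in $\overline{\operatorname{dom}A}$, and the family $\{S(t)\}_{t\ge0}$ is a nonexpansive semigroup on the nonempty set $\overline{\operatorname{dom}A}$. That is: 1. $\rho(S(t)x,S(t)y)\le\rho(x,y)$ for all $t\ge0$ and $x,y\in\overline{\operatorname{dom}A}$; 2. $S(s+t)=S(s)\circ S(t)$ for all $s,t\ge0$; 3. $S(0)$ is the identity of $\overline{\operatorname{dom}A}$; 4. for every $x\in\overline{\operatorname{dom}A}$ the map $t\mapsto S(t)x$ is continuous on $[0,\infty)$. -/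

import Mathlib

open Filter Topology
open scoped NNReal unitInterval

noncomputable section

namespace CAT0

/-- A normalized geodesic of a metric space: a map on `[0,1]` of constant speed. -/
structure NormalizedGeodesic (X : Type*) [MetricSpace X] where
  toFun : I → X
  exists_speed : ∃ K : ℝ, 0 ≤ K ∧ ∀ s t : I, dist (toFun s) (toFun t) = K * |(s : ℝ) - (t : ℝ)|

instance (X : Type*) [MetricSpace X] : CoeFun (NormalizedGeodesic X) (fun _ => I → X) where
  coe := NormalizedGeodesic.toFun

/-- `CAT(0)` spaces. First, any two points are joined by a geodesic. Second, the `CAT(0)`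
inequality: a geodesic triangle has vertices `v 0, v 1, v 2` and sides `c i` from `v i` to
`v (i + 1)` (indices mod 3); a comparison triangle has vertices `w 0, w 1, w 2` in the Euclidean
plane; the comparison point of `c i s` is the point of the side from `w i` to `w (i + 1)` which
divides it in the same ratio `s`. -/
class CAT0Space (X : Type*) [MetricSpace X] : Prop where
  exists_geodesic : ∀ x y : X, ∃ γ : NormalizedGeodesic X, γ 0 = x ∧ γ 1 = y
  comparison : ∀ (v : Fin 3 → X) (c : Fin 3 → NormalizedGeodesic X)
    (w : Fin 3 → EuclideanSpace ℝ (Fin 2)),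
    (∀ i, c i 0 = v i ∧ c i 1 = v (i + 1)) →
    (∀ i j, dist (w i) (w j) = dist (v i) (v j)) →
    ∀ (i j : Fin 3) (s t : I),
      dist (c i s) (c j t) ≤
        dist (AffineMap.lineMap (w i) (w (i + 1)) (s : ℝ))
          (AffineMap.lineMap (w j) (w (j + 1)) (t : ℝ))

/-- The geodesic extension property: every (nondegenerate) unit speed geodesic `γ : [0,L] → X`
extends to an isometry `ℝ → X`. -/
def GeodesicExtensionProperty (X : Type*) [MetricSpace X] : Prop :=
  ∀ (L : ℝ), 0 < L → ∀ γ : Set.Icc (0 : ℝ) L → X, Isometry γ →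
    ∃ η : ℝ → X, Isometry η ∧ ∀ t : Set.Icc (0 : ℝ) L, η t = γ t

/-- The comparison angle at `p` between `q` and `r`. For `q, r ≠ p` this is the angle at the vertex
over `p` of the Euclidean comparison triangle, given by the law of cosines. -/
def comparisonAngle {X : Type*} [MetricSpace X] (p q r : X) : ℝ :=
  open Classical in
  if q = p ∧ r = p then 0
  else if q = p ∨ r = p then Real.pi / 2
  else Real.arccos ((dist p q ^ 2 + dist p r ^ 2 - dist q r ^ 2) / (2 * dist p q * dist p r))

/-- Normalized geodesics issuing from `p`. -/
abbrev GeodesicFrom {X : Type*} [MetricSpace X] (p : X) : Type _ :=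
  {γ : NormalizedGeodesic X // γ 0 = p}

/-- The Alexandrov angle of two geodesics issuing from `p`: the limit, as `s, t → 0+`, of the
comparison angles at `p` between `γ₁ s` and `γ₂ t` (it exists in every `CAT(0)` space). -/
def alexandrovAngle {X : Type*} [MetricSpace X] {p : X} (γ₁ γ₂ : GeodesicFrom p) : ℝ :=
  limUnder (𝓝[>] (0 : I) ×ˢ 𝓝[>] (0 : I))
    (fun st : I × I => comparisonAngle p (γ₁.1 st.1) (γ₂.1 st.2))

/-- The indicator `ζ` of nonzero geodesics: `0` if the two endpoints agree, `1` otherwise. -/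
def geodesicZeta {X : Type*} [MetricSpace X] {p : X} (γ : GeodesicFrom p) : ℝ :=
  open Classical in if γ.1 0 = γ.1 1 then 0 else 1

theorem NormalizedGeodesic.eq_zero_iff {X : Type*} [MetricSpace X] (γ : NormalizedGeodesic X)
    {s : I} (hs : 0 < s) : γ s = γ 0 ↔ γ 0 = γ 1 := by
  obtain ⟨K, -, hK⟩ := γ.exists_speed
  have h1 := hK s 0
  have h2 := hK 0 1
  have hs' : (0 : ℝ) < s := hs
  simp only [Set.Icc.coe_zero, Set.Icc.coe_one, sub_zero, zero_sub, abs_neg, abs_one,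
    mul_one, abs_of_pos hs'] at h1 h2
  rw [← dist_eq_zero, ← dist_eq_zero (x := γ.toFun 0), h1, h2, mul_eq_zero]
  exact ⟨fun h => h.resolve_right hs'.ne', Or.inl⟩

instance nhdsGT_zero_neBot : (𝓝[>] (0 : I)).NeBot :=
  nhdsGT_neBot_of_exists_gt ⟨1, zero_lt_one⟩

theorem alexandrovAngle_of_ne {X : Type*} [MetricSpace X] {p : X} (γ₁ γ₂ : GeodesicFrom p)
    (h : ¬ (γ₁.1 0 = γ₁.1 1 ↔ γ₂.1 0 = γ₂.1 1)) : alexandrovAngle γ₁ γ₂ = Real.pi / 2 := by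
  apply Tendsto.limUnder_eq
  refine tendsto_const_nhds.congr' ?_
  have hpos : ∀ᶠ st : I × I in 𝓝[>] (0 : I) ×ˢ 𝓝[>] (0 : I), 0 < st.1 ∧ 0 < st.2 :=
    (eventually_mem_nhdsWithin.prod_mk eventually_mem_nhdsWithin)
  filter_upwards [hpos] with st hst
  have e1 := γ₁.1.eq_zero_iff hst.1
  have e2 := γ₂.1.eq_zero_iff hst.2
  have z1 : γ₁.1 0 = p := γ₁.2
  have z2 : γ₂.1 0 = p := γ₂.2
  rw [comparisonAngle]
  rw [← e1, ← e2, z1, z2] at h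
  rw [if_neg (by tauto), if_pos (by tauto)]

theorem geodesicZeta_eq {X : Type*} [MetricSpace X] {p : X} (γ₁ γ₂ : GeodesicFrom p)
    (h : alexandrovAngle γ₁ γ₂ = 0) : geodesicZeta γ₁ = geodesicZeta γ₂ := by
  by_contra hne
  have : alexandrovAngle γ₁ γ₂ = Real.pi / 2 := by
    apply alexandrovAngle_of_ne
    intro hiff
    apply hne
    unfold geodesicZeta
    by_cases h0 : γ₁.1 0 = γ₁.1 1
    · rw [if_pos h0, if_pos (hiff.1 h0)]
    · rw [if_neg h0, if_neg (fun h1 => h0 (hiff.2 h1))]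
  rw [this] at h
  exact Real.pi_div_two_pos.ne' h

/-- The space of directions `S_p`: the metric identification of the geodesics issuing from `p`
under the Alexandrov angle, that is, geodesics with angle zero are identified (in a `CAT(0)` space
the angle is a pseudometric, so that this is an equivalence relation). -/
def SpaceOfDirections {X : Type*} [MetricSpace X] (p : X) : Type _ :=
  Quot (fun γ₁ γ₂ : GeodesicFrom p => alexandrovAngle γ₁ γ₂ = 0)

namespace SpaceOfDirections

variable {X : Type*} [MetricSpace X] {p : X}

/-- The angle metric on the space of directions, read on representatives (in a `CAT(0)` space it
does not depend on them). -/
def angle (ξ₁ ξ₂ : SpaceOfDirections p) : ℝ :=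
  alexandrovAngle (Quot.out ξ₁) (Quot.out ξ₂)

/-- The indicator `ζ` on the space of directions. -/
def zeta (ξ : SpaceOfDirections p) : ℝ :=
  Quot.lift geodesicZeta geodesicZeta_eq ξ

theorem zeta_eq_zero_or_one (ξ : SpaceOfDirections p) : ξ.zeta = 0 ∨ ξ.zeta = 1 := by
  induction ξ using Quot.ind with
  | mk γ =>
    change geodesicZeta γ = 0 ∨ geodesicZeta γ = 1
    unfold geodesicZeta
    split_ifs <;> simp

end SpaceOfDirections

/-- The equivalence relation on `[0,∞) × S_p` that defines the tangent space at `p`. -/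
def tangentSetoid {X : Type*} [MetricSpace X] (p : X) : Setoid (ℝ≥0 × SpaceOfDirections p) where
  r a b := ((a.1 : ℝ) * a.2.zeta = 0 ∧ (b.1 : ℝ) * b.2.zeta = 0) ∨
    ((a.1 : ℝ) * a.2.zeta = (b.1 : ℝ) * b.2.zeta ∧ 0 < (a.1 : ℝ) * a.2.zeta ∧ a.2 = b.2)
  iseqv :=
    { refl := by
        intro a
        rcases a.2.zeta_eq_zero_or_one with h | h
        · left; simp [h]
        · rcases eq_or_lt_of_le a.1.coe_nonneg with h' | h'
          · left; simp [← h']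
          · right; simp [h, h']
      symm := by
        rintro a b (h | ⟨h1, h2, h3⟩)
        · exact Or.inl h.symm
        · exact Or.inr ⟨h1.symm, h1 ▸ h2, h3.symm⟩
      trans := by
        rintro a b c (h | ⟨h1, h2, h3⟩) (h' | ⟨h1', h2', h3'⟩)
        · exact Or.inl ⟨h.1, h'.2⟩
        · exact absurd h.2 h2'.ne'
        · exact absurd h'.1 (h1 ▸ h2).ne'
        · exact Or.inr ⟨h1.trans h1', h2, h3.trans h3'⟩ }

/-- The tangent space `T_p X`. -/
def TangentSpaceAt {X : Type*} [MetricSpace X] (p : X) : Type _ :=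
  Quotient (tangentSetoid p)

namespace TangentSpaceAt

variable {X : Type*} [MetricSpace X] {p : X}

/-- The tangent vector `t ξ` for `t ≥ 0` and a direction `ξ`. -/
def mk (t : ℝ≥0) (ξ : SpaceOfDirections p) : TangentSpaceAt p :=
  Quotient.mk (tangentSetoid p) (t, ξ)

/-- The distance on representatives of tangent vectors. -/
def preDist (a b : ℝ≥0 × SpaceOfDirections p) : ℝ :=
  Real.sqrt ((a.1 : ℝ) ^ 2 * a.2.zeta + (b.1 : ℝ) ^ 2 * b.2.zeta
    - 2 * a.1 * b.1 * a.2.zeta * b.2.zeta * Real.cos (a.2.angle b.2))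

theorem preDist_congr (a₁ b₁ a₂ b₂ : ℝ≥0 × SpaceOfDirections p)
    (ha : tangentSetoid p a₁ a₂) (hb : tangentSetoid p b₁ b₂) :
    preDist a₁ b₁ = preDist a₂ b₂ := by
  have key : ∀ x y : ℝ≥0 × SpaceOfDirections p, tangentSetoid p x y →
      (x.1 : ℝ) * x.2.zeta = (y.1 : ℝ) * y.2.zeta ∧
        ((y.1 : ℝ) * y.2.zeta = 0 ∨ x.2 = y.2) := by
    rintro x y (h | h)
    · exact ⟨h.1.trans h.2.symm, Or.inl h.2⟩
    · exact ⟨h.1, Or.inr h.2.2⟩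
  have form : ∀ x y : ℝ≥0 × SpaceOfDirections p, preDist x y =
      Real.sqrt (((x.1 : ℝ) * x.2.zeta) ^ 2 + ((y.1 : ℝ) * y.2.zeta) ^ 2
        - 2 * ((x.1 : ℝ) * x.2.zeta) * ((y.1 : ℝ) * y.2.zeta) * Real.cos (x.2.angle y.2)) := by
    intro x y
    unfold preDist
    congr 1
    rcases x.2.zeta_eq_zero_or_one with h | h <;> rcases y.2.zeta_eq_zero_or_one with h' | h' <;>
      simp [h, h']
  rw [form, form]
  obtain ⟨e1, h1⟩ := key _ _ ha
  obtain ⟨e2, h2⟩ := key _ _ hb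
  rw [e1, e2]
  rcases h1 with h1 | h1
  · simp [h1]
  rcases h2 with h2 | h2
  · simp [h2]
  rw [h1, h2]

/-- The metric `d_p` of the tangent space:
`d_p (t₁ξ₁, t₂ξ₂)² = t₁² ζ(ξ₁) + t₂² ζ(ξ₂) - 2 t₁ t₂ ζ(ξ₁) ζ(ξ₂) cos ∠(ξ₁, ξ₂)`. -/
def tdist (u v : TangentSpaceAt p) : ℝ :=
  Quotient.lift₂ preDist preDist_congr u v

end TangentSpaceAt

section HadamardSpace

variable {H : Type*} [MetricSpace H] [CAT0Space H]

/-- The normalized geodesic `γ_{p,x}` (unique in a `CAT(0)` space). -/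
def geodesicTo (p x : H) : GeodesicFrom p :=
  ⟨(CAT0Space.exists_geodesic p x).choose, (CAT0Space.exists_geodesic p x).choose_spec.1⟩

/-- The tangent vector `t γ_{p,x}` at `p`, for `t ≥ 0`. -/
def tangentTo (t : ℝ≥0) (p x : H) : TangentSpaceAt p :=
  TangentSpaceAt.mk t (Quot.mk _ (geodesicTo p x))

/-- The zero `0_p` of the tangent space. -/
def tangentZero (p : H) : TangentSpaceAt p := tangentTo 0 p p

/-- The norm `‖u‖_p = d_p(0_p, u)`. -/
def tnorm {p : H} (u : TangentSpaceAt p) : ℝ := (tangentZero p).tdist u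

/-- The product `g_p(u, v) = (‖u‖² + ‖v‖² - d_p(u, v)²) / 2`. -/
def tinner {p : H} (u v : TangentSpaceAt p) : ℝ :=
  (1 / 2) * (tnorm u ^ 2 + tnorm v ^ 2 - u.tdist v ^ 2)

variable (H) in
/-- Set-valued vector fields: `A p` is a subset of the tangent space at `p`. -/
abbrev VectorField : Type _ := ∀ p : H, Set (TangentSpaceAt p)

namespace VectorField

/-- The domain of a set-valued vector field. -/
def dom (A : VectorField H) : Set H := {p | (A p).Nonempty}

/-- Monotone vector fields; `tangentTo 1 p q` is `γ_{p,q}` as a tangent vector. -/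
def IsMonotone (A : VectorField H) : Prop :=
  ∀ (p q : H) (η : TangentSpaceAt p) (ν : TangentSpaceAt q), η ∈ A p → ν ∈ A q →
    tinner η (tangentTo 1 p q) ≤ - tinner ν (tangentTo 1 q p)

/-- The surjectivity condition: for all `t > 0` and `x` there is `p` with
`t ρ(p,x) γ_{p,x} ∈ A p`. -/
def SurjectivityCondition (A : VectorField H) : Prop :=
  ∀ (t : ℝ≥0) (x : H), 0 < t → ∃ p : H, tangentTo (t * nndist p x) p x ∈ A p

/-- The (a priori set-valued) resolvent: `J_l x = {z | l⁻¹ ρ(z,x) γ_{z,x} ∈ A z}` for `l > 0`,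
and `J_0` is the identity. -/
def resolvent (A : VectorField H) (l : ℝ≥0) (x : H) : Set H :=
  if l = 0 then {x} else {z | tangentTo (l⁻¹ * nndist z x) z x ∈ A z}

end VectorField

end HadamardSpace

/-- Nonexpansive semigroups `(S(t))_{t ≥ 0}` on a nonempty subset `C` of a metric space. -/
structure IsNonexpansiveSemigroup {X : Type*} [MetricSpace X] (C : Set X) (S : ℝ≥0 → C → C) :
    Prop where
  nonempty : C.Nonempty
  nonexpansive : ∀ (t : ℝ≥0) (x y : C), dist (S t x) (S t y) ≤ dist x y
  add : ∀ s t : ℝ≥0, S (s + t) = S s ∘ S t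
  zero : S 0 = id
  continuous : ∀ x : C, Continuous (fun t => S t x)

end CAT0

end

/-! ### Euclidean comparison triangles -/

namespace CAT0

/-! The resolvents behave as in a Hilbert space, and then the Crandall-Liggett argument runs on
distances alone.

In a CAT(0) space comparison angles decrease towards the vertex, so the Alexandrov angle is at most
the comparison angle. Hence `g_p(ρ(p,x)γ_{p,x}, ρ(p,q)γ_{p,q})` is at least its Euclidean value,
half of `ρ(p,x)² + ρ(p,q)² - ρ(x,q)²` (`le_tinner_tangentTo`). Inserted into monotonicity, this
gives a quadratic inequality between resolvent points with any two parameters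
(`IsMonotone.resolvent_comparison`). With equal parameters and Reshetnyak's inequality, resolvents
are single-valued and nonexpansive. Testing against a vector of `A x` gives `ρ(J_l x, x) ≤ l c` on
the domain.

For unequal parameters `l`, `m`, the same inequality is a recursion for the squared distances of
`J_l^i x` and `J_m^j x`, solved by the majorant `c²((il - jm)² + il² + jm²)`
(`dist_iterate_iterate_sq_le`). It tends to zero with the steps and with `il - jm`, uniformly for
bounded times. Nonexpansiveness carries this to the closure of the domain, and convergence, the
semigroup law and continuity follow. -/

theorem exists_comparison_triangle {X : Type*} [MetricSpace X] (v : Fin 3 → X) :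
    ∃ w : Fin 3 → EuclideanSpace ℝ (Fin 2), ∀ i j, dist (w i) (w j) = dist (v i) (v j) := by
  suffices h : ∃ w : Fin 3 → EuclideanSpace ℝ (Fin 2), dist (w 0) (w 1) = dist (v 0) (v 1) ∧
      dist (w 0) (w 2) = dist (v 0) (v 2) ∧ dist (w 1) (w 2) = dist (v 1) (v 2) by
    obtain ⟨w, h01, h02, h12⟩ := h
    refine ⟨w, fun i j => ?_⟩
    have h10 := h01
    have h20 := h02
    have h21 := h12
    rw [dist_comm, dist_comm (v _)] at h10 h20 h21
    fin_cases i <;> fin_cases j <;> simp [*]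
  have t1 := dist_triangle (v 0) (v 1) (v 2)
  have t2 := dist_triangle (v 1) (v 0) (v 2)
  have t3 := dist_triangle (v 0) (v 2) (v 1)
  rw [dist_comm (v 1) (v 0)] at t2
  rw [dist_comm (v 2) (v 1)] at t3
  have a0 : 0 ≤ dist (v 0) (v 1) := dist_nonneg
  have b0 : 0 ≤ dist (v 0) (v 2) := dist_nonneg
  have c0 : 0 ≤ dist (v 1) (v 2) := dist_nonneg
  generalize dist (v 0) (v 1) = a at *
  generalize dist (v 0) (v 2) = b at *
  generalize dist (v 1) (v 2) = c at *
  rcases a0.eq_or_lt with rfl | ha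
  · have hbc : c = b := by linarith
    subst hbc
    refine ⟨![!₂[0, 0], !₂[0, 0], !₂[c, 0]], ?_, ?_, ?_⟩ <;>
      simp [EuclideanSpace.dist_eq, Fin.sum_univ_two, Real.dist_eq, Real.sqrt_sq b0]
  -- The third vertex has abscissa `x` by the law of cosines; `|x| ≤ b` is the triangle inequality.
  · set x := (a ^ 2 + b ^ 2 - c ^ 2) / (2 * a) with hx
    have hxa : 2 * a * x = a ^ 2 + b ^ 2 - c ^ 2 := by rw [hx]; field_simp
    have hxb : |x| ≤ b := by
      rw [abs_le]
      constructor
      · by_contra! h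
        nlinarith
      · by_contra! h
        nlinarith
    have hy : 0 ≤ b ^ 2 - x ^ 2 := by
      have := sq_le_sq' (abs_le.1 hxb).1 (abs_le.1 hxb).2
      linarith
    refine ⟨![!₂[0, 0], !₂[a, 0], !₂[x, √(b ^ 2 - x ^ 2)]], ?_, ?_, ?_⟩
    · simp [EuclideanSpace.dist_eq, Fin.sum_univ_two, Real.dist_eq, Real.sqrt_sq a0]
    · simp only [EuclideanSpace.dist_eq, Fin.sum_univ_two, Real.dist_eq, sq_abs]
      rw [← Real.sqrt_sq b0]
      congr 1
      simp [Real.sq_sqrt hy, Real.sqrt_sq b0]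
    · simp only [EuclideanSpace.dist_eq, Fin.sum_univ_two, Real.dist_eq, sq_abs]
      rw [← Real.sqrt_sq c0]
      congr 1
      simp [Real.sq_sqrt hy]
      linarith

theorem dist_lineMap_sq {E : Type*} [NormedAddCommGroup E] [InnerProductSpace ℝ E]
    (a b c : E) (r : ℝ) :
    dist (AffineMap.lineMap a b r) c ^ 2 =
      (1 - r) * dist a c ^ 2 + r * dist b c ^ 2 - r * (1 - r) * dist a b ^ 2 := by
  have h1 : AffineMap.lineMap a b r - c = (1 - r) • (a - c) + r • (b - c) := by
    rw [AffineMap.lineMap_apply_module]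
    module
  have h2 : a - b = (a - c) - (b - c) := by abel
  rw [dist_eq_norm, dist_eq_norm, dist_eq_norm, dist_eq_norm, h1, h2, norm_add_sq_real,
    norm_sub_sq_real (a - c), norm_smul, norm_smul, inner_smul_left, inner_smul_right, mul_pow, mul_pow,
    Real.norm_eq_abs, Real.norm_eq_abs, sq_abs, sq_abs]
  simp only [conj_trivial]
  ring

/-! ### Quadratic forms of the CAT(0) inequality -/

section Space

variable {X : Type*} [MetricSpace X]

theorem NormalizedGeodesic.dist_eq (γ : NormalizedGeodesic X) (s t : I) :
    dist (γ s) (γ t) = dist (γ 0) (γ 1) * |(s : ℝ) - t| := by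
  obtain ⟨K, -, hK⟩ := γ.exists_speed
  rw [hK, hK]
  simp

theorem NormalizedGeodesic.dist_zero (γ : NormalizedGeodesic X) (s : I) :
    dist (γ 0) (γ s) = dist (γ 0) (γ 1) * s := by
  rw [γ.dist_eq]
  simp [abs_of_nonneg s.2.1]

/-- The initial segment of a geodesic, up to the parameter `u`. -/
def NormalizedGeodesic.initial (γ : NormalizedGeodesic X) (u : I) : NormalizedGeodesic X where
  toFun s := γ (s * u)
  exists_speed := by
    refine ⟨dist (γ 0) (γ 1) * u, mul_nonneg dist_nonneg u.2.1, fun s t => ?_⟩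
    rw [γ.dist_eq]
    simp only [Set.Icc.coe_mul]
    rw [← sub_mul, abs_mul, abs_of_nonneg u.2.1]
    ring

theorem NormalizedGeodesic.dist_sq_le [CAT0Space X] (γ : NormalizedGeodesic X) (y : X) (r : I) :
    dist (γ r) y ^ 2 ≤ (1 - r) * dist (γ 0) y ^ 2 + r * dist (γ 1) y ^ 2
      - r * (1 - r) * dist (γ 0) (γ 1) ^ 2 := by
  obtain ⟨γ₁, h10, h11⟩ := CAT0Space.exists_geodesic (γ 1) y
  obtain ⟨γ₂, h20, h21⟩ := CAT0Space.exists_geodesic y (γ 0)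
  obtain ⟨w, hw⟩ := exists_comparison_triangle ![γ 0, γ 1, y]
  -- Side `2` at parameter `0` is the vertex `y`, so this compares a point of the side `γ` with the
  -- opposite vertex.
  have key := CAT0Space.comparison ![γ 0, γ 1, y] ![γ, γ₁, γ₂] w
    (by intro i; fin_cases i <;> simp [*]) hw 0 2 r 0
  have e0 := hw 0 1
  have e1 := hw 0 2
  have e2 := hw 1 2
  simp only [Matrix.cons_val] at key e0 e1 e2
  rw [h20] at key
  simp only [Set.Icc.coe_zero, AffineMap.lineMap_apply_zero, zero_add] at key
  rw [← e0, ← e1, ← e2, ← dist_lineMap_sq]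
  exact pow_le_pow_left₀ dist_nonneg key 2

/-- The quadrilateral inequality of Reshetnyak. -/
theorem dist_sq_add_dist_sq_le [CAT0Space X] (x y p q : X) :
    dist x q ^ 2 + dist y p ^ 2 ≤
      dist p x ^ 2 + dist q y ^ 2 + 2 * dist x y * dist p q := by
  rcases eq_or_ne x y with rfl | hxy
  · rw [dist_self, dist_comm x q, dist_comm x p]; linarith
  rcases eq_or_ne p q with rfl | hpq
  · rw [dist_self, dist_comm x p, dist_comm y p]; linarith
  obtain ⟨γ, h0, h1⟩ := CAT0Space.exists_geodesic x q
  have ha : 0 < dist x y := dist_pos.2 hxy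
  have hb : 0 < dist p q := dist_pos.2 hpq
  set a := dist x y
  set b := dist p q with hb'
  have hab : 0 < a + b := by positivity
  -- The diagonal from `x` to `q` is cut in the ratio `a : b` of the sides `xy` and `pq`; the other
  -- diagonal is at most the detour `e + f` through this point.
  let r : I := ⟨a / (a + b), by positivity, by rw [div_le_one hab]; linarith⟩
  have hr : (r : ℝ) = a / (a + b) := rfl
  have hr' : 1 - (r : ℝ) = b / (a + b) := by rw [hr]; field_simp; ring
  have k1 := γ.dist_sq_le y r
  have k2 := γ.dist_sq_le p r
  rw [h0, h1, hr', hr] at k1 k2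
  have k3 := dist_triangle_left y p (γ r)
  set D := dist x q
  rw [show dist x y = a from rfl] at k1
  rw [dist_comm q p, ← hb', dist_comm x p] at k2
  set e := dist (γ r) y with he
  set f := dist (γ r) p with hf
  have k4 : dist y p ^ 2 ≤ (e + f) ^ 2 := pow_le_pow_left₀ dist_nonneg k3 2
  -- Weighted Cauchy-Schwarz; the weights make the coefficients of `dist p x ^ 2` and `dist q y ^ 2`
  -- equal in `b * k1' + a * k2'`.
  have k5 : a * b * (e + f) ^ 2 ≤ (a + b) * (b * e ^ 2 + a * f ^ 2) := by
    nlinarith [sq_nonneg (b * e - a * f)]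
  have k1' : (a + b) ^ 2 * e ^ 2 ≤
      (a + b) * (b * a ^ 2 + a * dist q y ^ 2) - a * b * D ^ 2 := by
    have := mul_le_mul_of_nonneg_left k1 (sq_nonneg (a + b))
    refine this.trans (le_of_eq ?_)
    field_simp
  have k2' : (a + b) ^ 2 * f ^ 2 ≤
      (a + b) * (b * dist p x ^ 2 + a * b ^ 2) - a * b * D ^ 2 := by
    have := mul_le_mul_of_nonneg_left k2 (sq_nonneg (a + b))
    refine this.trans (le_of_eq ?_)
    field_simp
  have k6 : (a * b * (a + b)) * (D ^ 2 + dist y p ^ 2) ≤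
      (a * b * (a + b)) * (dist p x ^ 2 + dist q y ^ 2 + 2 * a * b) := by
    have k4' := mul_le_mul_of_nonneg_left k4 (by positivity : 0 ≤ a * b * (a + b))
    have k5' := mul_le_mul_of_nonneg_left k5 hab.le
    have k1'' := mul_le_mul_of_nonneg_left k1' hb.le
    have k2'' := mul_le_mul_of_nonneg_left k2' ha.le
    linarith
  exact le_of_mul_le_mul_left k6 (by positivity)

/-! ### Comparison angles and Alexandrov angles -/

theorem comparisonAngle_comm (p q r : X) : comparisonAngle p q r = comparisonAngle p r q := by
  unfold comparisonAngle
  by_cases hq : q = p <;> by_cases hr : r = p <;> simp only [hq, hr, and_self, or_self,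
    and_true, and_false, or_true, or_false, if_true, if_false]
  rw [dist_comm r q, add_comm (dist p r ^ 2), mul_right_comm 2 (dist p r)]

theorem comparisonAngle_of_ne {p q r : X} (hq : q ≠ p) (hr : r ≠ p) :
    comparisonAngle p q r =
      Real.arccos ((dist p q ^ 2 + dist p r ^ 2 - dist q r ^ 2) / (2 * dist p q * dist p r)) := by
  rw [comparisonAngle, if_neg (by tauto), if_neg (by tauto)]

theorem comparisonAngle_nonneg (p q r : X) : 0 ≤ comparisonAngle p q r := by
  unfold comparisonAngle
  split_ifs
  · exact le_rfl
  · exact Real.pi_div_two_pos.le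
  · exact Real.arccos_nonneg _

theorem comparisonAngle_le_pi (p q r : X) : comparisonAngle p q r ≤ Real.pi := by
  unfold comparisonAngle
  split_ifs
  · exact Real.pi_pos.le
  · linarith [Real.pi_pos]
  · exact Real.arccos_le_pi _

theorem cos_comparisonAngle {p q r : X} (hq : q ≠ p) (hr : r ≠ p) :
    Real.cos (comparisonAngle p q r) =
      (dist p q ^ 2 + dist p r ^ 2 - dist q r ^ 2) / (2 * dist p q * dist p r) := by
  have h1 : 0 < dist p q := dist_pos.2 hq.symm
  have h2 : 0 < dist p r := dist_pos.2 hr.symm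
  have t1 := dist_triangle_left q r p
  have t2 := dist_triangle p q r
  have t3 := dist_triangle p r q
  rw [dist_comm r q] at t3
  have h3 : 0 ≤ dist q r := dist_nonneg
  rw [comparisonAngle_of_ne hq hr, Real.cos_arccos]
  · rw [le_div_iff₀ (by positivity)]; nlinarith
  · rw [div_le_iff₀ (by positivity)]; nlinarith

variable {p : X}

theorem GeodesicFrom.apply_ne {γ : GeodesicFrom p} (h : γ.1 0 ≠ γ.1 1) {s : I} (hs : 0 < s) :
    γ.1 s ≠ p :=
  fun e => h ((γ.1.eq_zero_iff hs).1 (e.trans γ.2.symm))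

theorem GeodesicFrom.apply_eq {γ : GeodesicFrom p} (h : γ.1 0 = γ.1 1) (s : I) :
    γ.1 s = p := by
  have := γ.1.dist_zero s
  rw [h, dist_self, zero_mul, dist_eq_zero, ← h, γ.2] at this
  exact this.symm

/-- By the law of cosines this is the quadratic CAT(0) inequality for the initial segment up to
`s'`, on which `γ s` divides in the ratio `s / s'`. -/
theorem comparisonAngle_mono_of_ne [CAT0Space X] (γ : GeodesicFrom p) (hγ : γ.1 0 ≠ γ.1 1)
    {y : X} (hy : y ≠ p) {s s' : I} (hs : 0 < s) (hss' : s ≤ s') :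
    comparisonAngle p (γ.1 s) y ≤ comparisonAngle p (γ.1 s') y := by
  have hs' : 0 < s' := hs.trans_le hss'
  have hp : γ.1 0 = p := γ.2
  have n1 : γ.1 s ≠ p := fun h => hγ ((γ.1.eq_zero_iff hs).1 (h.trans hp.symm))
  have n2 : γ.1 s' ≠ p := fun h => hγ ((γ.1.eq_zero_iff hs').1 (h.trans hp.symm))
  rw [comparisonAngle_of_ne n1 hy, comparisonAngle_of_ne n2 hy]
  apply Real.arccos_le_arccos
  have d1 := γ.1.dist_zero s
  have d2 := γ.1.dist_zero s'
  rw [hp] at d1 d2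
  set K := dist p (γ.1 1) with hKdef
  have hK : 0 < K := dist_pos.2 fun h => hγ (hp.trans h)
  have hsr : (0 : ℝ) < s := hs
  have hsr' : (0 : ℝ) < s' := hs'
  have hle : (s : ℝ) ≤ s' := hss'
  let r : I := ⟨s / s', by positivity, by rw [div_le_one hsr']; exact hle⟩
  have hr : (r : ℝ) = s / s' := rfl
  have hrs : r * s' = s := by
    apply Subtype.ext
    rw [Set.Icc.coe_mul, hr]
    field_simp
  have key := (γ.1.initial s').dist_sq_le y r
  simp only [NormalizedGeodesic.initial, hrs, zero_mul, one_mul, hp] at key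
  have hY : 0 < dist p y := dist_pos.2 hy.symm
  rw [d1, d2, div_le_div_iff₀ (by positivity) (by positivity)]
  rw [d2, hr] at key
  set B := dist p y
  have key' : s' * dist (γ.1 s) y ^ 2 ≤ (s' - s) * B ^ 2 + s * dist (γ.1 s') y ^ 2
      - s * (s' - s) * K ^ 2 * s' := by
    have := mul_le_mul_of_nonneg_left key hsr'.le
    refine this.trans (le_of_eq ?_)
    field_simp
  have := mul_le_mul_of_nonneg_left key' (by positivity : 0 ≤ 2 * K * B)
  linarith

theorem comparisonAngle_mono [CAT0Space X] (γ : GeodesicFrom p) (y : X) {s s' : I}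
    (hs : 0 < s) (hss' : s ≤ s') :
    comparisonAngle p (γ.1 s) y ≤ comparisonAngle p (γ.1 s') y := by
  by_cases h : γ.1 0 = γ.1 1
  · rw [GeodesicFrom.apply_eq h, GeodesicFrom.apply_eq h]
  · by_cases hy : y = p
    · simp [comparisonAngle, hy, GeodesicFrom.apply_ne h hs,
        GeodesicFrom.apply_ne h (hs.trans_le hss')]
    · exact comparisonAngle_mono_of_ne γ h hy hs hss'

/-- The limit is the infimum over positive pairs: a pair nearly attaining it bounds all smaller
pairs. -/
theorem tendsto_of_separately_monotone {f : I × I → ℝ} {m : ℝ} (hm : ∀ x, m ≤ f x)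
    (h₁ : ∀ s s' t : I, 0 < s → s ≤ s' → 0 < t → f (s, t) ≤ f (s', t))
    (h₂ : ∀ s t t' : I, 0 < s → 0 < t → t ≤ t' → f (s, t) ≤ f (s, t')) :
    ∃ l, Tendsto f (𝓝[>] (0 : I) ×ˢ 𝓝[>] (0 : I)) (𝓝 l) ∧ l ≤ f (1, 1) := by
  let A : Set ℝ := f '' {x | 0 < x.1 ∧ 0 < x.2}
  have hA : BddBelow A := ⟨m, by rintro _ ⟨x, -, rfl⟩; exact hm x⟩
  have hmem : f (1, 1) ∈ A := ⟨(1, 1), ⟨zero_lt_one, zero_lt_one⟩, rfl⟩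
  have hpos : ∀ᶠ st : I × I in 𝓝[>] (0 : I) ×ˢ 𝓝[>] (0 : I), 0 < st.1 ∧ 0 < st.2 :=
    eventually_mem_nhdsWithin.prod_mk eventually_mem_nhdsWithin
  refine ⟨sInf A, tendsto_order.2 ⟨fun a ha => ?_, fun a ha => ?_⟩, csInf_le hA hmem⟩
  · filter_upwards [hpos] with st hst
    exact ha.trans_le (csInf_le hA ⟨st, hst, rfl⟩)
  · obtain ⟨_, ⟨x, hx, rfl⟩, hxa⟩ := exists_lt_of_csInf_lt ⟨_, hmem⟩ ha
    have hev : ∀ᶠ st : I × I in 𝓝[>] (0 : I) ×ˢ 𝓝[>] (0 : I), st.1 < x.1 ∧ st.2 < x.2 :=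
      (eventually_nhdsWithin_of_eventually_nhds (eventually_lt_nhds hx.1)).prod_mk
        (eventually_nhdsWithin_of_eventually_nhds (eventually_lt_nhds hx.2))
    filter_upwards [hpos, hev] with st h0 h1
    exact ((h₁ _ _ _ h0.1 h1.1.le h0.2).trans (h₂ _ _ _ hx.1 h0.2 h1.2.le)).trans_lt hxa

theorem exists_tendsto_comparisonAngle [CAT0Space X] (γ₁ γ₂ : GeodesicFrom p) :
    ∃ l, Tendsto (fun st : I × I => comparisonAngle p (γ₁.1 st.1) (γ₂.1 st.2))
      (𝓝[>] (0 : I) ×ˢ 𝓝[>] (0 : I)) (𝓝 l) ∧ l ≤ comparisonAngle p (γ₁.1 1) (γ₂.1 1) := by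
  refine tendsto_of_separately_monotone
    (f := fun st : I × I => comparisonAngle p (γ₁.1 st.1) (γ₂.1 st.2))
    (m := 0) (fun _ => comparisonAngle_nonneg _ _ _) (fun s s' t hs hss' ht => ?_)
    (fun s t t' hs ht htt' => ?_)
  · exact comparisonAngle_mono γ₁ _ hs hss'
  · rw [comparisonAngle_comm, comparisonAngle_comm p (γ₁.1 s)]
    exact comparisonAngle_mono γ₂ _ ht htt'

theorem tendsto_alexandrovAngle [CAT0Space X] (γ₁ γ₂ : GeodesicFrom p) :
    Tendsto (fun st : I × I => comparisonAngle p (γ₁.1 st.1) (γ₂.1 st.2))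
      (𝓝[>] (0 : I) ×ˢ 𝓝[>] (0 : I)) (𝓝 (alexandrovAngle γ₁ γ₂)) :=
  tendsto_nhds_limUnder ((exists_tendsto_comparisonAngle γ₁ γ₂).imp fun _ h => h.1)

theorem alexandrovAngle_le [CAT0Space X] (γ₁ γ₂ : GeodesicFrom p) :
    alexandrovAngle γ₁ γ₂ ≤ comparisonAngle p (γ₁.1 1) (γ₂.1 1) := by
  obtain ⟨l, hl, hle⟩ := exists_tendsto_comparisonAngle γ₁ γ₂
  rwa [← tendsto_nhds_unique hl (tendsto_alexandrovAngle γ₁ γ₂)]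

theorem alexandrovAngle_mem_Icc [CAT0Space X] (γ₁ γ₂ : GeodesicFrom p) :
    alexandrovAngle γ₁ γ₂ ∈ Set.Icc 0 Real.pi :=
  isClosed_Icc.mem_of_tendsto (tendsto_alexandrovAngle γ₁ γ₂)
    (Eventually.of_forall fun _ => ⟨comparisonAngle_nonneg _ _ _, comparisonAngle_le_pi _ _ _⟩)

theorem alexandrovAngle_comm [CAT0Space X] (γ₁ γ₂ : GeodesicFrom p) :
    alexandrovAngle γ₁ γ₂ = alexandrovAngle γ₂ γ₁ := by
  refine tendsto_nhds_unique (tendsto_alexandrovAngle γ₁ γ₂) ?_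
  refine ((tendsto_alexandrovAngle γ₂ γ₁).comp tendsto_prod_swap).congr fun st => ?_
  exact comparisonAngle_comm _ _ _

/-- The parameter of a geodesic of length `a` at which it has run the length `u ≤ a`. -/
noncomputable def arcParam (a u : ℝ) : I := Set.projIcc 0 1 zero_le_one (u / a)

theorem coe_arcParam {a u : ℝ} (ha : 0 < a) (hu : 0 ≤ u) (hua : u ≤ a) :
    (arcParam a u : ℝ) = u / a := by
  rw [arcParam, Set.projIcc_of_mem zero_le_one ⟨by positivity, (div_le_one ha).2 hua⟩]

theorem tendsto_arcParam {a : ℝ} (ha : 0 < a) :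
    Tendsto (arcParam a) (𝓝[>] 0) (𝓝[>] 0) := by
  refine tendsto_nhdsWithin_iff.2 ⟨?_, ?_⟩
  · have h : Continuous (arcParam a) := continuous_projIcc.comp (continuous_id.div_const a)
    have h0 : arcParam a 0 = 0 := Subtype.ext (by rw [coe_arcParam ha le_rfl ha.le]; simp)
    exact (h0 ▸ h.tendsto 0).mono_left nhdsWithin_le_nhds
  · filter_upwards [self_mem_nhdsWithin, nhdsWithin_le_nhds (Iic_mem_nhds ha)] with u hu hua
    have hu' : 0 < u := hu
    refine (show (0 : ℝ) < (arcParam a u : ℝ) from ?_)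
    rw [coe_arcParam ha hu'.le hua]
    positivity

theorem eventually_dist_arcParam {γ : GeodesicFrom p} (h : γ.1 0 ≠ γ.1 1) :
    ∀ᶠ u in 𝓝[>] (0 : ℝ), dist p (γ.1 (arcParam (dist (γ.1 0) (γ.1 1)) u)) = u := by
  have ha := dist_pos.2 h
  filter_upwards [self_mem_nhdsWithin, nhdsWithin_le_nhds (Iic_mem_nhds ha)] with u hu hua
  have hu' : 0 < u := hu
  have := γ.1.dist_zero (arcParam (dist (γ.1 0) (γ.1 1)) u)
  rw [coe_arcParam ha hu'.le hua, mul_div_cancel₀ _ ha.ne'] at this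
  rwa [show dist (γ.1 0) (γ.1 (arcParam (dist (γ.1 0) (γ.1 1)) u)) =
    dist p (γ.1 (arcParam (dist (γ.1 0) (γ.1 1)) u)) from congrArg (dist · _) γ.2] at this

/-- The angle is determined by the distances of the points at equal distance from the vertex. -/
theorem tendsto_dist_arcParam_div [CAT0Space X] {γ₁ γ₂ : GeodesicFrom p} (h₁ : γ₁.1 0 ≠ γ₁.1 1)
    (h₂ : γ₂.1 0 ≠ γ₂.1 1) :
    Tendsto (fun u => dist (γ₁.1 (arcParam (dist (γ₁.1 0) (γ₁.1 1)) u))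
      (γ₂.1 (arcParam (dist (γ₂.1 0) (γ₂.1 1)) u)) / u) (𝓝[>] 0)
      (𝓝 (√(2 - 2 * Real.cos (alexandrovAngle γ₁ γ₂)))) := by
  have hlim := (tendsto_alexandrovAngle γ₁ γ₂).comp
    ((tendsto_arcParam (dist_pos.2 h₁)).prodMk (tendsto_arcParam (dist_pos.2 h₂)))
  have hlim' := (((Real.continuous_cos.tendsto _).comp hlim).const_mul 2).const_sub 2
  refine hlim'.sqrt.congr' ?_
  filter_upwards [eventually_dist_arcParam h₁, eventually_dist_arcParam h₂, self_mem_nhdsWithin]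
    with u e1 e2 hu
  have hu' : 0 < u := hu
  have n1 := dist_pos.1 (e1 ▸ hu')
  have n2 := dist_pos.1 (e2 ▸ hu')
  simp only [Function.comp]
  rw [cos_comparisonAngle n1.symm n2.symm, e1, e2,
    ← Real.sqrt_sq (div_nonneg dist_nonneg hu'.le)]
  -- In an isosceles triangle with legs `u` the squared base is `u² (2 - 2 cos)`.
  congr 1
  field_simp
  ring

/-- The full triangle inequality for angles is not needed. At equal arc length `u`, angle zero means
that the points of `γ₁` and `γ₂` are `o(u)` apart, so their distances to the point of `γ₃` have the
same limit after division by `u`. -/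
theorem alexandrovAngle_congr_left [CAT0Space X] {γ₁ γ₂ : GeodesicFrom p}
    (h : alexandrovAngle γ₁ γ₂ = 0) (γ₃ : GeodesicFrom p) :
    alexandrovAngle γ₁ γ₃ = alexandrovAngle γ₂ γ₃ := by
  have hiff : γ₁.1 0 = γ₁.1 1 ↔ γ₂.1 0 = γ₂.1 1 := by
    by_contra hn
    rw [alexandrovAngle_of_ne _ _ hn] at h
    exact Real.pi_div_two_pos.ne' h
  by_cases h1 : γ₁.1 0 = γ₁.1 1
  · unfold alexandrovAngle
    simp only [GeodesicFrom.apply_eq h1, GeodesicFrom.apply_eq (hiff.1 h1)]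
  have h2 : γ₂.1 0 ≠ γ₂.1 1 := fun e => h1 (hiff.2 e)
  by_cases h3 : γ₃.1 0 = γ₃.1 1
  · rw [alexandrovAngle_of_ne _ _ (by tauto), alexandrovAngle_of_ne _ _ (by tauto)]
  have l12 := tendsto_dist_arcParam_div h1 h2
  have l13 := tendsto_dist_arcParam_div h1 h3
  have l23 := tendsto_dist_arcParam_div h2 h3
  rw [h, Real.cos_zero, mul_one, sub_self, Real.sqrt_zero] at l12
  have hz := squeeze_zero_norm' (a := fun u => dist
    (γ₁.1 (arcParam (dist (γ₁.1 0) (γ₁.1 1)) u)) (γ₂.1 (arcParam (dist (γ₂.1 0) (γ₂.1 1)) u)) / u)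
    (f := fun u => dist (γ₁.1 (arcParam (dist (γ₁.1 0) (γ₁.1 1)) u))
      (γ₃.1 (arcParam (dist (γ₃.1 0) (γ₃.1 1)) u)) / u -
      dist (γ₂.1 (arcParam (dist (γ₂.1 0) (γ₂.1 1)) u))
      (γ₃.1 (arcParam (dist (γ₃.1 0) (γ₃.1 1)) u)) / u) ?_ l12
  · have heq := sub_eq_zero.1 (tendsto_nhds_unique (l13.sub l23) hz)
    rw [Real.sqrt_inj (by linarith [Real.cos_le_one (alexandrovAngle γ₁ γ₃)])
      (by linarith [Real.cos_le_one (alexandrovAngle γ₂ γ₃)])] at heq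
    exact Real.injOn_cos (alexandrovAngle_mem_Icc _ _) (alexandrovAngle_mem_Icc _ _)
      (by linarith)
  · filter_upwards [self_mem_nhdsWithin] with u hu
    have hu' : 0 < u := hu
    rw [← sub_div, Real.norm_eq_abs, abs_div, abs_of_pos hu']
    gcongr
    exact abs_dist_sub_le _ _ _

/-- Equality in a `Quot` only gives the generated equivalence relation; this makes the angle
independent of the representatives picked by `Quot.out`. -/
theorem alexandrovAngle_congr_of_eqvGen [CAT0Space X] {γ₁ γ₂ : GeodesicFrom p}
    (h : Relation.EqvGen (fun γ₁ γ₂ : GeodesicFrom p => alexandrovAngle γ₁ γ₂ = 0) γ₁ γ₂)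
    (γ₃ : GeodesicFrom p) : alexandrovAngle γ₁ γ₃ = alexandrovAngle γ₂ γ₃ := by
  induction h with
  | rel _ _ h => exact alexandrovAngle_congr_left h γ₃
  | refl => rfl
  | symm _ _ _ ih => exact ih.symm
  | trans _ _ _ _ _ ih₁ ih₂ => exact ih₁.trans ih₂

/-! ### Directions and tangent vectors -/

/-- The direction of a geodesic. -/
def SpaceOfDirections.mk (γ : GeodesicFrom p) : SpaceOfDirections p := Quot.mk _ γ

theorem SpaceOfDirections.angle_mk [CAT0Space X] (γ₁ γ₂ : GeodesicFrom p) :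
    (SpaceOfDirections.mk γ₁).angle (SpaceOfDirections.mk γ₂) = alexandrovAngle γ₁ γ₂ := by
  have h : ∀ γ : GeodesicFrom p,
      Relation.EqvGen (fun γ₁ γ₂ : GeodesicFrom p => alexandrovAngle γ₁ γ₂ = 0)
        (Quot.out (SpaceOfDirections.mk γ)) γ :=
    fun γ => Quot.eqvGen_exact (Quot.out_eq _)
  unfold SpaceOfDirections.angle
  rw [alexandrovAngle_congr_of_eqvGen (h γ₁), alexandrovAngle_comm,
    alexandrovAngle_congr_of_eqvGen (h γ₂), alexandrovAngle_comm]

theorem TangentSpaceAt.tdist_mk_sq (s t : ℝ≥0) (ξ ξ' : SpaceOfDirections p) :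
    (mk s ξ).tdist (mk t ξ') ^ 2 = (s : ℝ) ^ 2 * ξ.zeta + (t : ℝ) ^ 2 * ξ'.zeta
      - 2 * s * t * ξ.zeta * ξ'.zeta * Real.cos (ξ.angle ξ') := by
  change preDist (s, ξ) (t, ξ') ^ 2 = _
  unfold preDist
  rw [Real.sq_sqrt]
  simp only
  have h1 := Real.cos_le_one (ξ.angle ξ')
  have h2 : 0 ≤ (s : ℝ) * t := by positivity
  rcases ξ.zeta_eq_zero_or_one with h | h <;> rcases ξ'.zeta_eq_zero_or_one with h' | h' <;>
    rw [h, h']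
  · simp
  · simp
  · simp
  · nlinarith [sq_nonneg ((s : ℝ) - t)]

theorem zeta_mk_of_ne {γ : GeodesicFrom p} (h : γ.1 0 ≠ γ.1 1) :
    (SpaceOfDirections.mk γ).zeta = 1 :=
  if_neg h

section Tangent

variable [CAT0Space X]

theorem geodesicTo_one (p x : X) : (geodesicTo p x).1 1 = x :=
  (CAT0Space.exists_geodesic p x).choose_spec.2

theorem tangentTo_eq_mk (t : ℝ≥0) (p x : X) :
    tangentTo t p x = TangentSpaceAt.mk t (SpaceOfDirections.mk (geodesicTo p x)) :=
  rfl

theorem tnorm_mk_sq (t : ℝ≥0) (ξ : SpaceOfDirections p) :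
    tnorm (TangentSpaceAt.mk t ξ) ^ 2 = (t : ℝ) ^ 2 * ξ.zeta := by
  unfold tnorm tangentZero
  rw [tangentTo_eq_mk, TangentSpaceAt.tdist_mk_sq]
  simp

theorem tinner_mk (s t : ℝ≥0) (ξ ξ' : SpaceOfDirections p) :
    tinner (TangentSpaceAt.mk s ξ) (TangentSpaceAt.mk t ξ') =
      s * t * ξ.zeta * ξ'.zeta * Real.cos (ξ.angle ξ') := by
  unfold tinner
  rw [tnorm_mk_sq, tnorm_mk_sq, TangentSpaceAt.tdist_mk_sq]
  ring

/-- The vector `γ_{p,x}` has norm at most one however far away `x` is, so the bound is uniform in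
`x`. -/
theorem exists_neg_le_tinner (u : TangentSpaceAt p) :
    ∃ c : ℝ, ∀ x : X, -c ≤ tinner u (tangentTo 1 p x) := by
  induction u using Quotient.ind with
  | _ a =>
    obtain ⟨t, ξ⟩ := a
    refine ⟨t, fun x => ?_⟩
    change _ ≤ tinner (TangentSpaceAt.mk t ξ) _
    rw [tangentTo_eq_mk, tinner_mk]
    generalize SpaceOfDirections.mk (geodesicTo p x) = ξ'
    have h1 := Real.neg_one_le_cos (ξ.angle ξ')
    have h2 : (0 : ℝ) ≤ t := t.2
    rcases ξ.zeta_eq_zero_or_one with h | h <;> rcases ξ'.zeta_eq_zero_or_one with h' | h' <;>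
      rw [h, h'] <;> push_cast <;> nlinarith

/-- Angles are at most comparison angles, so cosines are at least those of the law of cosines. The
factor `dist p q` appears because `γ_{p,q}` is normalized as a tangent vector. -/
theorem le_tinner_tangentTo (r : ℝ≥0) (p x q : X) :
    r * (dist p x ^ 2 + dist p q ^ 2 - dist x q ^ 2) ≤
      2 * dist p q * tinner (tangentTo (r * nndist p x) p x) (tangentTo 1 p q) := by
  rcases eq_or_ne x p with rfl | hx
  · simp [tangentTo_eq_mk, tinner_mk]
  rcases eq_or_ne q p with rfl | hq
  · simp [dist_comm]
  have hx' : (geodesicTo p x).1 0 ≠ (geodesicTo p x).1 1 := by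
    rw [geodesicTo_one, (geodesicTo p x).2]; exact hx.symm
  have hq' : (geodesicTo p q).1 0 ≠ (geodesicTo p q).1 1 := by
    rw [geodesicTo_one, (geodesicTo p q).2]; exact hq.symm
  rw [tangentTo_eq_mk, tangentTo_eq_mk, tinner_mk, zeta_mk_of_ne hx', zeta_mk_of_ne hq',
    SpaceOfDirections.angle_mk]
  have hle := alexandrovAngle_le (geodesicTo p x) (geodesicTo p q)
  rw [geodesicTo_one, geodesicTo_one] at hle
  have hcos := Real.cos_le_cos_of_nonneg_of_le_pi (alexandrovAngle_mem_Icc _ _).1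
    (comparisonAngle_le_pi _ _ _) hle
  have h1 : 0 < dist p x := dist_pos.2 hx.symm
  have h2 : 0 < dist p q := dist_pos.2 hq.symm
  rw [cos_comparisonAngle hx hq, div_le_iff₀ (by positivity)] at hcos
  have := mul_le_mul_of_nonneg_left hcos r.coe_nonneg
  push_cast [coe_nndist]
  linarith

end Tangent

end Space

/-! ### The Crandall-Liggett argument in a metric space -/

section CrandallLiggett

theorem natCast_mul_div {t : ℝ≥0} {k : ℕ} (hk : k ≠ 0) :
    (k : ℝ) * ((t / (k : ℝ≥0) : ℝ≥0) : ℝ) = t := by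
  push_cast
  field_simp

variable {X : Type*} [MetricSpace X]

theorem dist_limit_iterate_le {J : ℝ≥0 → X → X} {x z w : X} {ε T δ : ℝ} {s t : ℝ≥0} (hδ : 0 < δ)
    (H : ∀ (l m : ℝ≥0) (i j : ℕ), (l : ℝ) < δ → (m : ℝ) < δ → (i * l : ℝ) ≤ T →
      (j * m : ℝ) ≤ T → |(i * l - j * m : ℝ)| < δ →
      dist ((J l)^[i] x) ((J m)^[j] x) ≤ ε)
    (hz : Tendsto (fun k : ℕ => (J (s / (k : ℝ≥0)))^[k] x) atTop (𝓝 z))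
    (hw : Tendsto (fun k : ℕ => (J (t / (k : ℝ≥0)))^[k] x) atTop (𝓝 w))
    (hs : (s : ℝ) ≤ T) (ht : (t : ℝ) ≤ T) (hst : |(s - t : ℝ)| < δ) : dist z w ≤ ε := by
  refine le_of_tendsto (hz.dist hw) ?_
  filter_upwards [(tendsto_const_div_atTop_nhds_zero_nat (s : ℝ)).eventually
      (gt_mem_nhds hδ), (tendsto_const_div_atTop_nhds_zero_nat (t : ℝ)).eventually
      (gt_mem_nhds hδ), eventually_ne_atTop 0] with j h1 h2 hj0
  refine H _ _ _ _ (by simpa using h1) (by simpa using h2) ?_ ?_ ?_ <;>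
    simpa only [natCast_mul_div hj0]

/-- Families of maps with the properties of the resolvents of a monotone vector field with
domain `D`. -/
structure IsResolventFamily (D : Set X) (J : ℝ≥0 → X → X) : Prop where
  zero : J 0 = id
  mem : ∀ (l : ℝ≥0) (x : X), 0 < l → J l x ∈ D
  nonexpansive : ∀ (l : ℝ≥0) (x y : X), dist (J l x) (J l y) ≤ dist x y
  comparison : ∀ (l m : ℝ≥0) (x y : X),
    ((l : ℝ) + m) * dist (J l x) (J m y) ^ 2 ≤
      m * dist x (J m y) ^ 2 + l * dist (J l x) y ^ 2
  bound : ∀ x ∈ D, ∃ c : ℝ, ∀ l : ℝ≥0, dist (J l x) x ≤ l * c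

namespace IsResolventFamily

variable {D : Set X} {J : ℝ≥0 → X → X} (hJ : IsResolventFamily D J)

include hJ

theorem dist_iterate_le (l : ℝ≥0) (n : ℕ) (x y : X) :
    dist ((J l)^[n] x) ((J l)^[n] y) ≤ dist x y := by
  induction n with
  | zero => simp
  | succ n ih =>
    rw [Function.iterate_succ_apply', Function.iterate_succ_apply']
    exact (hJ.nonexpansive _ _ _).trans ih

theorem dist_iterate_self_le {x : X} {c : ℝ} (hc : ∀ l : ℝ≥0, dist (J l x) x ≤ l * c)
    (l : ℝ≥0) (n : ℕ) : dist ((J l)^[n] x) x ≤ n * l * c := by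
  induction n with
  | zero => simp
  | succ n ih =>
    have h1 : dist ((J l)^[n + 1] x) (J l x) ≤ dist ((J l)^[n] x) x := by
      rw [Function.iterate_succ_apply']
      exact hJ.nonexpansive _ _ _
    have h2 := dist_triangle ((J l)^[n + 1] x) (J l x) x
    have h3 := hc l
    push_cast
    linarith

theorem dist_iterate_iterate_sq_le {x : X} {c : ℝ} (hc : ∀ l : ℝ≥0, dist (J l x) x ≤ l * c)
    (l m : ℝ≥0) (i j : ℕ) :
    dist ((J l)^[i] x) ((J m)^[j] x) ^ 2 ≤
      c ^ 2 * ((i * l - j * m : ℝ) ^ 2 + i * (l : ℝ) ^ 2 + j * (m : ℝ) ^ 2) := by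
  have hl : (0 : ℝ) ≤ l := l.2
  have hm : (0 : ℝ) ≤ m := m.2
  -- The recursion is divided by `l + m`, so `l = m = 0` is set aside.
  rcases (add_nonneg hl hm).eq_or_lt with h0 | hpos
  · have hl0 : l = 0 := NNReal.coe_eq_zero.1 (by linarith)
    have hm0 : m = 0 := NNReal.coe_eq_zero.1 (by linarith)
    subst hl0 hm0
    simp [hJ.zero]
  induction i generalizing j with
  | zero =>
    have h := hJ.dist_iterate_self_le hc m j
    rw [dist_comm] at h
    have h2 := pow_le_pow_left₀ dist_nonneg h 2
    have : 0 ≤ c ^ 2 * (j * (m : ℝ) ^ 2) := by positivity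
    simp only [Function.iterate_zero, id]
    push_cast
    nlinarith
  | succ i ihi =>
    induction j with
    | zero =>
      have h := hJ.dist_iterate_self_le hc l (i + 1)
      have h2 := pow_le_pow_left₀ dist_nonneg h 2
      have : 0 ≤ c ^ 2 * (((i + 1 : ℕ) : ℝ) * (l : ℝ) ^ 2) := by positivity
      simp only [Function.iterate_zero, id]
      push_cast at *
      nlinarith
    | succ j ihj =>
      have h := hJ.comparison l m ((J l)^[i] x) ((J m)^[j] x)
      rw [← Function.iterate_succ_apply' (J l), ← Function.iterate_succ_apply' (J m)] at h
      have h1 := mul_le_mul_of_nonneg_left (ihi (j + 1)) hm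
      have h2 := mul_le_mul_of_nonneg_left ihj hl
      -- The majorant satisfies the recursion with equality: with `u = (i+1)l - (j+1)m`, the excess
      -- of `m(u-l)² + l(u+m)²` over `(l+m)u²` is `lm(l+m)`, which the linear terms lose.
      refine le_of_mul_le_mul_left (h.trans ((add_le_add h1 h2).trans (le_of_eq ?_))) hpos
      push_cast
      ring

theorem exists_forall_dist_le {x : X} (hx : x ∈ closure D) (T : ℝ) {ε : ℝ} (hε : 0 < ε) :
    ∃ δ > 0, ∀ (l m : ℝ≥0) (i j : ℕ), (l : ℝ) < δ → (m : ℝ) < δ → (i * l : ℝ) ≤ T →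
      (j * m : ℝ) ≤ T → |(i * l - j * m : ℝ)| < δ →
      dist ((J l)^[i] x) ((J m)^[j] x) ≤ ε := by
  -- The bound needs a point of `D`. Replacing `x` by `y` costs `ε / 4` for each iterate, which
  -- leaves `ε / 2` for `y`.
  obtain ⟨y, hy, hxy⟩ := Metric.mem_closure_iff.1 hx (ε / 4) (by positivity)
  obtain ⟨c, hc⟩ := hJ.bound y hy
  have hlim : Tendsto (fun d : ℝ => c ^ 2 * (d ^ 2 + T * d + T * d)) (𝓝[>] 0) (𝓝 0) := by
    have : Continuous (fun d : ℝ => c ^ 2 * (d ^ 2 + T * d + T * d)) := by fun_prop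
    exact (Tendsto.mono_right (this.tendsto 0) (by simp)).mono_left
      nhdsWithin_le_nhds
  have hev := (hlim.eventually (gt_mem_nhds (by positivity : (0 : ℝ) < (ε / 2) ^ 2))).and
    self_mem_nhdsWithin
  obtain ⟨δ, hδ, hδ0⟩ := hev.exists
  refine ⟨δ, hδ0, fun l m i j hl hm hi hj hij => ?_⟩
  have h1 := hJ.dist_iterate_iterate_sq_le hc l m i j
  have hsq : (i * l - j * m : ℝ) ^ 2 ≤ δ ^ 2 := sq_le_sq' (abs_lt.1 hij).1.le (abs_lt.1 hij).2.le
  have h2 : ∀ (a : ℝ≥0) (n : ℕ), (a : ℝ) < δ → (n * a : ℝ) ≤ T → n * (a : ℝ) ^ 2 ≤ T * δ := by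
    intro a n ha hn
    have h3 : (0 : ℝ) ≤ n * a := by positivity
    calc n * (a : ℝ) ^ 2 = (n * a) * a := by ring
      _ ≤ T * δ := mul_le_mul hn ha.le a.2 (h3.trans hn)
  have h4 : dist ((J l)^[i] y) ((J m)^[j] y) ^ 2 ≤ (ε / 2) ^ 2 := by
    refine h1.trans (le_trans ?_ hδ.le)
    exact mul_le_mul_of_nonneg_left
      (add_le_add (add_le_add hsq (h2 l i hl hi)) (h2 m j hm hj)) (sq_nonneg c)
  have h5 : dist ((J l)^[i] y) ((J m)^[j] y) ≤ ε / 2 :=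
    le_of_sq_le_sq h4 (by positivity)
  have h6 := hJ.dist_iterate_le l i x y
  have h7 := hJ.dist_iterate_le m j y x
  rw [dist_comm y x] at h7
  have h8 := dist_triangle4 ((J l)^[i] x) ((J l)^[i] y) ((J m)^[j] y) ((J m)^[j] x)
  linarith

theorem exists_tendsto [CompleteSpace X] {x : X} (hx : x ∈ closure D) (t : ℝ≥0) :
    ∃ z ∈ closure D, Tendsto (fun k : ℕ => (J (t / (k : ℝ≥0)))^[k] x) atTop (𝓝 z) := by
  have hcauchy : CauchySeq (fun k : ℕ => (J (t / (k : ℝ≥0)))^[k] x) := by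
    rw [Metric.cauchySeq_iff']
    intro ε hε
    obtain ⟨δ, hδ, h⟩ := hJ.exists_forall_dist_le hx t (half_pos hε)
    have hev := ((tendsto_const_div_atTop_nhds_zero_nat (t : ℝ)).eventually
      (gt_mem_nhds hδ)).and (eventually_ne_atTop 0)
    obtain ⟨N, hN⟩ := eventually_atTop.1 hev
    refine ⟨N, fun n hn => (h _ _ _ _ ?_ ?_ ?_ ?_ ?_).trans_lt (half_lt_self hε)⟩
    · simpa using (hN n hn).1
    · simpa using (hN N le_rfl).1
    · exact (natCast_mul_div (hN n hn).2).le
    · exact (natCast_mul_div (hN N le_rfl).2).le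
    · rw [natCast_mul_div (hN n hn).2, natCast_mul_div (hN N le_rfl).2]
      simpa using hδ
  obtain ⟨z, hz⟩ := cauchySeq_tendsto_of_complete hcauchy
  refine ⟨z, ?_, hz⟩
  refine isClosed_closure.mem_of_tendsto hz ?_
  filter_upwards [eventually_ne_atTop 0] with k hk
  rcases eq_or_ne t 0 with rfl | ht
  · simpa [hJ.zero] using hx
  · obtain ⟨n, rfl⟩ := Nat.exists_eq_succ_of_ne_zero hk
    rw [Function.iterate_succ_apply']
    exact subset_closure (hJ.mem _ _ (by positivity))

/-- The limit depends only on the total time, not on the step sizes. This freedom gives the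
semigroup law. -/
theorem tendsto_iterate {x z : X} (hx : x ∈ closure D) {t : ℝ≥0}
    (hz : Tendsto (fun k : ℕ => (J (t / (k : ℝ≥0)))^[k] x) atTop (𝓝 z))
    {h : ℕ → ℝ≥0} {n : ℕ → ℕ} (hh : Tendsto (fun k => (h k : ℝ)) atTop (𝓝 0))
    (hn : Tendsto (fun k => (n k * h k : ℝ)) atTop (𝓝 t)) :
    Tendsto (fun k => (J (h k))^[n k] x) atTop (𝓝 z) := by
  rw [Metric.tendsto_atTop]
  intro ε hε
  obtain ⟨δ, hδ, H⟩ := hJ.exists_forall_dist_le hx (t + 1) (half_pos hε)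
  have e1 := hh.eventually (gt_mem_nhds hδ)
  have e2 := hn.eventually (Metric.ball_mem_nhds (t : ℝ) hδ)
  have e3 := hn.eventually (gt_mem_nhds (lt_add_one (t : ℝ)))
  obtain ⟨N, hN⟩ := eventually_atTop.1 (e1.and (e2.and e3))
  refine ⟨N, fun k hk => lt_of_le_of_lt ?_ (half_lt_self hε)⟩
  obtain ⟨h1, h2, h3⟩ := hN k hk
  refine le_of_tendsto (tendsto_const_nhds.dist hz) ?_
  filter_upwards [(tendsto_const_div_atTop_nhds_zero_nat (t : ℝ)).eventually
      (gt_mem_nhds hδ), eventually_ne_atTop 0] with j hj hj0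
  refine H _ _ _ _ h1 (by simpa using hj) h3.le ?_ ?_
  · rw [natCast_mul_div hj0]; linarith
  · rw [natCast_mul_div hj0, ← Real.dist_eq]
    exact h2

theorem exists_semigroup [CompleteSpace X] (hD : D.Nonempty) :
    ∃ S : ℝ≥0 → closure D → closure D,
      (∀ (t : ℝ≥0) (x : closure D),
        Tendsto (fun k : ℕ => (J (t / (k : ℝ≥0)))^[k] (x : X)) atTop (𝓝 (S t x : X))) ∧
      IsNonexpansiveSemigroup (closure D) S := by
  choose! S hSmem hS using fun (x : X) (hx : x ∈ closure D) (t : ℝ≥0) => hJ.exists_tendsto hx t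
  refine ⟨fun t x => ⟨S x t, hSmem x x.2 t⟩, fun t x => hS x x.2 t, hD.closure, ?_, ?_, ?_, ?_⟩
  · intro t x y
    exact le_of_tendsto ((hS x x.2 t).dist (hS y y.2 t))
      (Eventually.of_forall fun k => hJ.dist_iterate_le _ _ _ _)
  · intro s t
    funext x
    apply Subtype.ext
    change S x (s + t) = S (S x t) s
    -- The times `s`, `t` and `s + t` are approximated with one common step `1 / (k + 1)`, so that
    -- the iterates compose exactly; using the sum of the two floors avoids comparing it with the
    -- floor of the sum.
    have hh : Tendsto (fun k : ℕ => (((1 : ℝ≥0) / ((k : ℝ≥0) + 1) : ℝ≥0) : ℝ)) atTop (𝓝 0) := by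
      simpa using tendsto_one_div_add_atTop_nhds_zero_nat (𝕜 := ℝ)
    have hfl : ∀ a : ℝ≥0, Tendsto (fun k : ℕ => ((⌊(a : ℝ) * (k + 1)⌋₊ : ℝ) *
        (((1 : ℝ≥0) / ((k : ℝ≥0) + 1) : ℝ≥0) : ℝ))) atTop (𝓝 a) := by
      intro a
      have := (tendsto_nat_floor_mul_div_atTop (R := ℝ) a.2).comp
        (tendsto_atTop_add_const_right atTop (1 : ℝ) tendsto_natCast_atTop_atTop)
      refine this.congr fun k => ?_
      simp [div_eq_mul_inv]
    have h1 := hJ.tendsto_iterate x.2 (hS x x.2 t) hh (hfl t)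
    have h2 := hJ.tendsto_iterate (hSmem x x.2 t) (hS _ (hSmem x x.2 t) s) hh (hfl s)
    have h3 := hJ.tendsto_iterate x.2 (hS x x.2 (s + t)) hh
      (n := fun k => ⌊(s : ℝ) * (k + 1)⌋₊ + ⌊(t : ℝ) * (k + 1)⌋₊) (by
        push_cast
        simpa [add_mul] using (hfl s).add (hfl t))
    refine tendsto_nhds_unique h3 ?_
    rw [tendsto_iff_dist_tendsto_zero] at h1 h2 ⊢
    have h4 := h1.add h2
    rw [add_zero] at h4
    refine squeeze_zero (fun _ => dist_nonneg) (fun k => ?_) h4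
    rw [Function.iterate_add_apply]
    exact (dist_triangle _ _ _).trans (add_le_add (hJ.dist_iterate_le _ _ _ _) le_rfl)
  · funext x
    apply Subtype.ext
    change S x 0 = x
    exact tendsto_nhds_unique (hS x x.2 0) (by simp [hJ.zero])
  · intro x
    rw [continuous_iff_continuousAt]
    intro t
    rw [ContinuousAt, Metric.tendsto_nhds]
    intro ε hε
    obtain ⟨δ, hδ, H⟩ := hJ.exists_forall_dist_le x.2 (t + 1) (half_pos hε)
    filter_upwards [Metric.ball_mem_nhds t hδ, Metric.ball_mem_nhds t one_pos] with s h1 h2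
    refine lt_of_le_of_lt ?_ (half_lt_self hε)
    rw [Metric.mem_ball, NNReal.dist_eq] at h1 h2
    change dist (S x s) (S x t) ≤ ε / 2
    exact dist_limit_iterate_le hδ H (hS x x.2 s) (hS x x.2 t) (by linarith [(abs_lt.1 h2).2])
      (by linarith) h1

end IsResolventFamily

end CrandallLiggett

/-! ### Resolvents of monotone vector fields -/

namespace VectorField

variable {H : Type*} [MetricSpace H] [CAT0Space H] {A : VectorField H}

theorem IsMonotone.comparison (hA : A.IsMonotone) {r s : ℝ≥0} {p q x y : H}
    (hp : tangentTo (r * nndist p x) p x ∈ A p) (hq : tangentTo (s * nndist q y) q y ∈ A q) :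
    r * (dist p x ^ 2 + dist p q ^ 2 - dist x q ^ 2) +
      s * (dist q y ^ 2 + dist p q ^ 2 - dist y p ^ 2) ≤ 0 := by
  have h1 := le_tinner_tangentTo r p x q
  have h2 := le_tinner_tangentTo s q y p
  rw [dist_comm q p] at h2
  have h3 := hA p q _ _ hp hq
  have h4 : 0 ≤ dist p q := dist_nonneg
  nlinarith

theorem mem_resolvent {l : ℝ≥0} (hl : 0 < l) {x z : H} :
    z ∈ A.resolvent l x ↔ tangentTo (l⁻¹ * nndist z x) z x ∈ A z := by
  rw [resolvent, if_neg hl.ne']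
  rfl

/-- The two resolvent points `p`, `q` are compared as in Hilbert space. -/
theorem IsMonotone.resolvent_comparison (hA : A.IsMonotone) {l m : ℝ≥0} {p q x y : H}
    (hp : p ∈ A.resolvent l x) (hq : q ∈ A.resolvent m y) :
    ((l : ℝ) + m) * dist p q ^ 2 ≤ m * dist x q ^ 2 + l * dist p y ^ 2
      - m * dist p x ^ 2 - l * dist q y ^ 2 := by
  rcases eq_or_ne l 0 with rfl | hl
  · rw [resolvent, if_pos rfl, Set.mem_singleton_iff] at hp
    subst hp
    simp
  rcases eq_or_ne m 0 with rfl | hm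
  · rw [resolvent, if_pos rfl, Set.mem_singleton_iff] at hq
    subst hq
    simp
  replace hl := pos_iff_ne_zero.2 hl
  replace hm := pos_iff_ne_zero.2 hm
  have h := hA.comparison ((mem_resolvent hl).1 hp) ((mem_resolvent hm).1 hq)
  have hl' : (0 : ℝ) < l := hl
  have hm' : (0 : ℝ) < m := hm
  rw [dist_comm y p] at h
  push_cast at h
  -- Multiplication by `l * m` clears the inverses and exchanges the weights.
  have h' := mul_le_mul_of_nonneg_left h (by positivity : (0 : ℝ) ≤ l * m)
  rw [mul_add, mul_zero] at h'
  have e : ∀ a b : ℝ, (l : ℝ) * m * ((l : ℝ)⁻¹ * a) + l * m * ((m : ℝ)⁻¹ * b) = m * a + l * b := by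
    intro a b
    field_simp
  rw [e] at h'
  linarith

theorem IsMonotone.dist_resolvent_le (hA : A.IsMonotone) {l : ℝ≥0} {p q x y : H}
    (hp : p ∈ A.resolvent l x) (hq : q ∈ A.resolvent l y) : dist p q ≤ dist x y := by
  rcases eq_or_ne l 0 with rfl | hl
  · rw [resolvent, if_pos rfl, Set.mem_singleton_iff] at hp hq
    rw [hp, hq]
  have hl' : (0 : ℝ) < l := NNReal.coe_pos.2 (pos_iff_ne_zero.2 hl)
  have h1 := hA.resolvent_comparison hp hq
  -- Reshetnyak's inequality turns the comparison into `dist p q ^ 2 ≤ dist x y * dist p q`.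
  have h2 := mul_le_mul_of_nonneg_left (dist_sq_add_dist_sq_le x y p q) hl'.le
  rw [dist_comm y p] at h2
  by_contra! hlt
  have h3 : 0 < dist p q := dist_nonneg.trans_lt hlt
  have h4 := mul_pos hl' (mul_pos h3 (sub_pos.2 hlt))
  nlinarith

theorem exists_resolvent_eq_singleton (hA : A.IsMonotone) (hsurj : A.SurjectivityCondition)
    (l : ℝ≥0) (x : H) : ∃ z, A.resolvent l x = {z} := by
  rcases eq_or_ne l 0 with rfl | hl
  · exact ⟨x, if_pos rfl⟩
  · have hl' := pos_iff_ne_zero.2 hl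
    obtain ⟨z, hz⟩ := hsurj l⁻¹ x (inv_pos.2 hl')
    refine ⟨z, Set.eq_singleton_iff_unique_mem.2 ⟨(mem_resolvent hl').2 hz, fun w hw => ?_⟩⟩
    have := hA.dist_resolvent_le hw ((mem_resolvent hl').2 hz)
    rw [dist_self] at this
    exact dist_le_zero.1 this

theorem IsMonotone.exists_dist_resolvent_self_le (hA : A.IsMonotone) {x : H} (hx : x ∈ A.dom) :
    ∃ c : ℝ, ∀ (l : ℝ≥0) (p : H), p ∈ A.resolvent l x → dist p x ≤ l * c := by
  obtain ⟨η, hη⟩ := hx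
  obtain ⟨c, hc⟩ := exists_neg_le_tinner η
  refine ⟨c, fun l p hp => ?_⟩
  rcases eq_or_ne l 0 with rfl | hl
  · rw [resolvent, if_pos rfl, Set.mem_singleton_iff] at hp
    simp [hp]
  have hl' := pos_iff_ne_zero.2 hl
  have hl'' : (0 : ℝ) < l := hl'
  rw [mem_resolvent hl'] at hp
  have h1 := hA p x _ η hp hη
  have h2 := hc p
  have h3 := le_tinner_tangentTo l⁻¹ p x x
  -- If `p = x`, only `0 ≤ c` is needed; it follows from monotonicity of `η` against itself.
  rcases eq_or_ne p x with rfl | hpx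
  · have h4 := hA p p η η hη hη
    have h5 : tinner η (tangentTo 1 p p) ≤ c := by linarith
    rw [dist_self]
    have : 0 ≤ c := by linarith
    positivity
  have hd : 0 < dist p x := dist_pos.2 hpx
  rw [dist_self] at h3
  push_cast at h3
  have h4 : (l : ℝ)⁻¹ * dist p x ≤ c := by
    refine le_trans (le_of_mul_le_mul_left ?_ (by positivity : 0 < 2 * dist p x))
      (h1.trans (by linarith))
    linarith
  rwa [inv_mul_le_iff₀ hl''] at h4

theorem isResolventFamily (hA : A.IsMonotone) {J : ℝ≥0 → H → H}
    (hJ : ∀ l x, A.resolvent l x = {J l x}) : IsResolventFamily A.dom J := by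
  have hmem : ∀ l x, J l x ∈ A.resolvent l x := fun l x => by rw [hJ]; rfl
  refine ⟨?_, ?_, ?_, ?_, ?_⟩
  · funext x
    have := hmem 0 x
    rwa [resolvent, if_pos rfl] at this
  · exact fun l x hl => ⟨_, (mem_resolvent hl).1 (hmem l x)⟩
  · exact fun l x y => hA.dist_resolvent_le (hmem l x) (hmem l y)
  · intro l m x y
    have h1 := hA.resolvent_comparison (hmem l x) (hmem m y)
    have h2 : 0 ≤ (m : ℝ) * dist (J l x) x ^ 2 := by positivity
    have h3 : 0 ≤ (l : ℝ) * dist (J m y) y ^ 2 := by positivity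
    linarith
  · intro x hx
    obtain ⟨c, hc⟩ := hA.exists_dist_resolvent_self_le hx
    exact ⟨c, fun l => hc l _ (hmem l x)⟩

end VectorField

end CAT0

theorem theorem5p3 {H : Type*} [MetricSpace H] [CompleteSpace H] [Nonempty H] [CAT0.CAT0Space H]
    (hext : CAT0.GeodesicExtensionProperty H)
    (A : CAT0.VectorField H) (hmono : A.IsMonotone) (hsurj : A.SurjectivityCondition) :
    ∃ J : ℝ≥0 → H → H, (∀ (l : ℝ≥0) (x : H), A.resolvent l x = {J l x}) ∧
      ∃ S : ℝ≥0 → closure A.dom → closure A.dom,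
        (∀ (t : ℝ≥0) (x : closure A.dom),
          Tendsto (fun k : ℕ => (J (t / (k : ℝ≥0)))^[k] (x : H)) atTop (𝓝 (S t x : H))) ∧
        CAT0.IsNonexpansiveSemigroup (closure A.dom) S := by
  choose J hJ using CAT0.VectorField.exists_resolvent_eq_singleton hmono hsurj
  obtain ⟨x⟩ := ‹Nonempty H›
  -- Surjectivity at any parameter shows that the domain is nonempty.
  obtain ⟨p, hp⟩ := hsurj 1 x one_pos
  exact ⟨J, hJ, (CAT0.VectorField.isResolventFamily hmono hJ).exists_semigroup ⟨p, _, hp⟩⟩
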